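/- For a finite simple graph $G$, a set $S$ of vertices is a fixing set of $G$ if the only automorphism of $G$ that fixes every vertex of $S$ is the identity; the fixing number $\mathrm{fix}(G)$ is the smallest cardinality of a fixing set of $G$. For a finite group $\Gamma$, the fixing set of $\Gamma$ is $$\mathrm{fix}(\Gamma)=\{\mathrm{fix}(G) : G \text{ is a finite simple graph with } \mathrm{Aut}(G)\cong\Gamma\}.$$ The elementary divisors of a finite abelian group $\Gamma$ are the prime powers $q_1,\dots,q_k>1$ (listed with multiplicity, unique up to order) for which $\Gamma\cong \mathbb{Z}_{q_1}\times\cdots\times\mathbb{Z}_{q_k}$. **Theorem.** Let $\Gamma$ be a non-trivial finite abelian group, and let $k$ be the number of elementary divisors of $\Gamma$. Then $\mathrm{fix}(\Gamma)=\{1,\ldots,k\}$. -/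

import Mathlib

/-- The (pointwise) stabilizer of a set `S` of vertices, as a subgroup of the automorphism
group `G ≃g G` of `G`. -/
def vertexStabilizer {V : Type*} (G : SimpleGraph V) (S : Finset V) : Subgroup (G ≃g G) where
  carrier := {g | ∀ v ∈ S, g v = v}
  one_mem' := fun _ _ => rfl
  mul_mem' := by
    intro a b ha hb v hv
    rw [RelIso.mul_apply, hb v hv, ha v hv]
  inv_mem' := by
    intro a ha v hv
    have h : a⁻¹ (a v) = v := RelIso.inv_apply_self a v
    rwa [ha v hv] at h

/-- `S` is a fixing set of the graph `G` if its stabilizer is trivial. -/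
def IsFixingSet {V : Type*} (G : SimpleGraph V) (S : Finset V) : Prop :=
  vertexStabilizer G S = ⊥

/-- The fixing number of a finite graph: the smallest cardinality of a fixing set. The set of all
vertices is a fixing set, so the infimum is attained. -/
noncomputable def fixingNumber {V : Type*} [Finite V] (G : SimpleGraph V) : ℕ :=
  sInf {n | ∃ S : Finset V, S.card = n ∧ IsFixingSet G S}

/-- The fixing set of a group `Γ`: the set of all fixing numbers of finite (simple) graphs whose
automorphism group is isomorphic to `Γ`. -/
def fixingNumbers (Γ : Type*) [Group Γ] : Set ℕ :=
  {n | ∃ (V : Type) (_ : Finite V) (G : SimpleGraph V),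
    Nonempty ((G ≃g G) ≃* Γ) ∧ fixingNumber G = n}

/-- `q 0, …, q (k - 1)` is a list of the elementary divisors of the abelian group `Γ`: each is a
prime power greater than 1, and `Γ` is isomorphic to the direct product of the cyclic groups of
these orders. Such a list exists for every finite `Γ`, and is unique up to order. -/
def IsElementaryDivisors (Γ : Type*) [CommGroup Γ] {k : ℕ} (q : Fin k → ℕ) : Prop :=
  (∀ i, IsPrimePow (q i)) ∧ Nonempty (Γ ≃* ((i : Fin k) → Multiplicative (ZMod (q i))))

/-- Every finite abelian group has a list of elementary divisors. -/
theorem exists_isElementaryDivisors (Γ : Type*) [CommGroup Γ] [Finite Γ] :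
    ∃ (k : ℕ) (q : Fin k → ℕ), IsElementaryDivisors Γ q := by
  classical
  obtain ⟨ι, _, p, hp, e, ⟨f⟩⟩ := AddCommGroup.equiv_directSum_zmod_of_finite (Additive Γ)
  let J := {i : ι // e i ≠ 0}
  let s : Fin (Fintype.card J) ≃ J := (Fintype.equivFin J).symm
  refine ⟨Fintype.card J, fun i => p (s i) ^ e (s i), fun i => ?_, ⟨?_⟩⟩
  · exact (hp _).isPrimePow.pow (s i).2
  · let F : Additive Γ ≃+ ((i : ι) → ZMod (p i ^ e i)) := f.trans (DirectSum.addEquivProd _)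
    have hsub : ∀ i, ¬ e i ≠ 0 → Subsingleton (ZMod (p i ^ e i)) := by
      intro i hi
      rw [not_not.mp hi, pow_zero]
      infer_instance
    let r : ((i : ι) → ZMod (p i ^ e i)) →+
        ((j : Fin (Fintype.card J)) → ZMod (p (s j) ^ e (s j))) :=
      { toFun := fun x j => x (s j)
        map_zero' := rfl
        map_add' := fun _ _ => rfl }
    have hr : Function.Bijective r := by
      constructor
      · intro x y h
        funext i
        by_cases hi : e i ≠ 0
        · have h1 := congrFun h (s.symm ⟨i, hi⟩)
          have h2 : ∀ j : J, s.symm j = s.symm ⟨i, hi⟩ → x j = y j := by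
            intro j hj
            have h3 : j = s (s.symm ⟨i, hi⟩) := by rw [← hj, s.apply_symm_apply]
            rw [h3]
            exact h1
          exact h2 ⟨i, hi⟩ rfl
        · exact (hsub i hi).elim _ _
      · intro y
        have h1 : ∀ i : ι, ∃ z : ZMod (p i ^ e i), ∀ j (h : (s j : ι) = i),
            z = h ▸ y j := by
          intro i
          by_cases hi : e i ≠ 0
          · obtain ⟨j0, hj0⟩ := s.surjective ⟨i, hi⟩
            have h0 : (s j0 : ι) = i := by rw [hj0]
            refine ⟨h0 ▸ y j0, fun j h => ?_⟩
            have hj : j0 = j := s.injective (Subtype.ext (h0.trans h.symm))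
            subst hj
            rfl
          · exact ⟨0, fun j h => absurd (h ▸ (s j).2) hi⟩
        choose x hx using h1
        exact ⟨x, funext fun j => hx (s j) j rfl⟩
    let K := F.trans (AddEquiv.ofBijective r hr)
    exact
      { toFun := fun g j => Multiplicative.ofAdd (K (Additive.ofMul g) j)
        invFun := fun y => (K.symm fun j => (y j).toAdd).toMul
        left_inv := fun g => by simp
        right_inv := fun y => by simp
        map_mul' := fun a b => by
          funext j
          simp [ofMul_mul, map_add] }

/-! Upper bound: in the abelian group Aut(G), the elements of squarefree order generate a socle
whose order has exactly k prime factors. Greedily chosen vertices, at most k of them, have a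
stabilizer meeting the socle trivially. That stabilizer is then trivial, since the socle meets every
nontrivial subgroup (`exists_socle`).

Realization: for 1 ≤ n ≤ k, distributing the k cyclic factors over n nonempty classes writes Γ as a
product of n nontrivial groups. Copies of each factor's Cayley graph, with colours made rigid by
`labelledGraph`, give a graph with this automorphism group in which each vertex is moved by at most
one factor. A fixing set must therefore contain a vertex for every factor, and one for each suffices
(`card_mem_fixingNumbers_pi`). -/

/-! ### Bases of permutation groups and the socle -/

/-- Choosing vertices greedily, each new stabilizer in a chain has smaller order, so the number of
prime factors of the order of a group of automorphisms bounds the size of a base. -/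
theorem exists_card_le_inf_vertexStabilizer_eq_bot {V : Type*} [Finite V] (G : SimpleGraph V)
    (A : Subgroup (G ≃g G)) :
    ∃ S : Finset V, S.card ≤ ArithmeticFunction.cardFactors (Nat.card A) ∧
      A ⊓ vertexStabilizer G S = ⊥ := by
  classical
  have : Finite (G ≃g G) := Finite.of_injective (fun e v => e v) DFunLike.coe_injective
  induction hn : Nat.card A using Nat.strong_induction_on generalizing A with
  | _ n ih =>
    subst hn
    by_cases hA : A = ⊥
    · exact ⟨∅, by simp, by simp [hA]⟩
    obtain ⟨⟨g, hgA⟩, hg'⟩ := Subgroup.ne_bot_iff_exists_ne_one.1 hA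
    have hg : g ≠ 1 := fun h => hg' (Subtype.ext h)
    obtain ⟨v, hv⟩ : ∃ v, g v ≠ v := by
      by_contra! h
      exact hg (RelIso.ext h)
    set B := A ⊓ vertexStabilizer G {v}
    have hBA : B ≤ A := inf_le_left
    have hdvd : Nat.card B ∣ Nat.card A := Subgroup.card_dvd_of_le hBA
    have hne : Nat.card B ≠ Nat.card A := by
      intro h
      have : B = A := Subgroup.eq_of_le_of_card_ge hBA h.ge
      rw [← this] at hgA
      exact hv (hgA.2 v (by simp))
    have hpos : 0 < Nat.card A := Nat.card_pos
    have hlt : Nat.card B < Nat.card A := lt_of_le_of_ne (Nat.le_of_dvd hpos hdvd) hne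
    obtain ⟨S, hS, hS'⟩ := ih _ hlt B rfl
    refine ⟨insert v S, ?_, ?_⟩
    · obtain ⟨c, hc⟩ := hdvd
      have hB0 : Nat.card B ≠ 0 := Nat.card_pos.ne'
      have hc0 : c ≠ 0 := by rintro rfl; omega
      have hc1 : c ≠ 1 := by rintro rfl; simp at hc; exact hne hc.symm
      rw [hc, ArithmeticFunction.cardFactors_mul hB0 hc0]
      have : 0 < ArithmeticFunction.cardFactors c :=
        ArithmeticFunction.cardFactors_pos_iff_one_lt.2 (by omega)
      have := Finset.card_insert_le v S
      omega
    · rw [eq_bot_iff, ← hS']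
      intro x hx
      exact ⟨⟨hx.1, fun w hw => hx.2 w (by simp_all)⟩, fun w hw => hx.2 w (by simp_all)⟩

theorem card_ker_powMonoidHom_of_dvd {C : Type*} [CommGroup C] [Finite C] [IsCyclic C] {d : ℕ}
    (hd : d ∣ Nat.card C) : Nat.card (powMonoidHom d : C →* C).ker = d := by
  rw [IsCyclic.card_powMonoidHom_ker, Nat.gcd_eq_right hd]

/-- The socle of a finite abelian group with `k` elementary divisors has an order with `k` prime
factors, and it meets every nontrivial subgroup. -/
theorem exists_socle {k : ℕ} (q : Fin k → ℕ) (hq : ∀ i, IsPrimePow (q i)) :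
    ∃ A : Subgroup ((i : Fin k) → Multiplicative (ZMod (q i))),
      ArithmeticFunction.cardFactors (Nat.card A) = k ∧
      ∀ K : Subgroup ((i : Fin k) → Multiplicative (ZMod (q i))), A ⊓ K = ⊥ → K = ⊥ := by
  have : ∀ i, NeZero (q i) := fun i => ⟨(hq i).ne_zero⟩
  have : ∀ i, Finite (Multiplicative (ZMod (q i))) := fun i =>
    inferInstanceAs (Finite (ZMod (q i)))
  have hcard : ∀ i, Nat.card (Multiplicative (ZMod (q i))) = q i := fun i => by
    rw [Nat.card_congr Multiplicative.toAdd, Nat.card_zmod]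
  let p : Fin k → ℕ := fun i => (q i).minFac
  have hp : ∀ i, (p i).Prime := fun i => Nat.minFac_prime (hq i).ne_one
  refine ⟨Subgroup.pi Set.univ fun i => (powMonoidHom (p i)).ker, ?_, ?_⟩
  · have e : (Subgroup.pi Set.univ fun i =>
        (powMonoidHom (p i) : Multiplicative (ZMod (q i)) →* _).ker) ≃
        ((i : Fin k) → (powMonoidHom (p i) : Multiplicative (ZMod (q i)) →* _).ker) :=
      { toFun := fun x i => ⟨x.1 i, x.2 i trivial⟩
        invFun := fun y => ⟨fun i => (y i).1, fun i _ => (y i).2⟩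
        left_inv := fun _ => rfl
        right_inv := fun _ => rfl }
    rw [Nat.card_congr e, Nat.card_pi]
    have : ∀ i, Nat.card (powMonoidHom (p i) : Multiplicative (ZMod (q i)) →* _).ker = p i :=
      fun i => card_ker_powMonoidHom_of_dvd (by rw [hcard]; exact Nat.minFac_dvd _)
    simp only [this]
    have key : ∀ s : Finset (Fin k),
        ArithmeticFunction.cardFactors (∏ i ∈ s, p i) = s.card := by
      classical
      intro s
      induction s using Finset.induction_on with
      | empty => simp
      | insert a s ha ih =>
        rw [Finset.prod_insert ha, ArithmeticFunction.cardFactors_mul (hp a).ne_zero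
          (Finset.prod_ne_zero_iff.2 fun i _ => (hp i).ne_zero), ih,
          ArithmeticFunction.cardFactors_apply_prime (hp a), Finset.card_insert_of_notMem ha,
          add_comm]
    simpa using key Finset.univ
  · intro K hK
    by_contra hne
    have h1 : Nat.card K ≠ 1 := fun h => hne (Subgroup.card_eq_one.1 h)
    obtain ⟨r, hr, hrK⟩ := Nat.exists_prime_and_dvd h1
    have := Fact.mk hr
    obtain ⟨x, hx⟩ := exists_prime_orderOf_dvd_card' r hrK
    have hxr : x ^ r = 1 := hx ▸ pow_orderOf_eq_one x
    have hx1 : (x : (i : Fin k) → Multiplicative (ZMod (q i))) = 1 := by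
      rw [← Subgroup.mem_bot, ← hK]
      refine ⟨fun i _ => ?_, x.2⟩
      have hi : (x.1 i) ^ r = 1 := congrFun (congrArg Subtype.val hxr) i
      change (x.1 i) ^ (p i) = 1
      -- A coordinate of an element of order r has order 1 or r. In the second case r is the only
      -- prime dividing `q i`, namely `p i`.
      rcases (Nat.dvd_prime hr).1 (orderOf_dvd_of_pow_eq_one hi) with h | h
      · rw [orderOf_eq_one_iff.1 h, one_pow]
      · have hrq : r ∣ q i := (h ▸ orderOf_dvd_natCard (x.1 i)).trans (hcard i).dvd
        obtain ⟨s, m, hs, hm, hsm⟩ := (isPrimePow_nat_iff _).1 (hq i)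
        have hrs : r = s := (Nat.prime_dvd_prime_iff_eq hr hs).1
          (hr.dvd_of_dvd_pow (hsm.symm ▸ hrq))
        have hps : p i = s := (Nat.prime_dvd_prime_iff_eq (hp i) hs).1
          ((hp i).dvd_of_dvd_pow ((Nat.minFac_dvd (q i)).trans hsm.symm.dvd))
        rw [hps, ← hrs, hi]
    have : x = 1 := Subtype.ext hx1
    rw [this, orderOf_one] at hx
    exact hr.one_lt.ne hx

/-! ### Bounds on the fixing number -/

theorem fixingNumber_le {V : Type*} [Finite V] {G : SimpleGraph V} {S : Finset V}
    (hS : IsFixingSet G S) : fixingNumber G ≤ S.card :=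
  Nat.sInf_le ⟨S, rfl, hS⟩

theorem isFixingSet_iff {V : Type*} {G : SimpleGraph V} {S : Finset V} :
    IsFixingSet G S ↔ ∀ g : G ≃g G, (∀ v ∈ S, g v = v) → g = 1 := by
  rw [IsFixingSet, Subgroup.eq_bot_iff_forall]
  rfl

theorem exists_isFixingSet_card_eq {V : Type*} [Finite V] (G : SimpleGraph V) :
    ∃ S : Finset V, S.card = fixingNumber G ∧ IsFixingSet G S := by
  have := Fintype.ofFinite V
  exact Nat.sInf_mem (s := {n | ∃ S : Finset V, S.card = n ∧ IsFixingSet G S})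
    ⟨_, Finset.univ, rfl, isFixingSet_iff.2 fun g hg => RelIso.ext fun v => hg v (by simp)⟩

theorem fixingNumber_pos {V : Type*} [Finite V] (G : SimpleGraph V) [Nontrivial (G ≃g G)] :
    1 ≤ fixingNumber G := by
  obtain ⟨S, hS, hfix⟩ := exists_isFixingSet_card_eq G
  rw [Nat.one_le_iff_ne_zero, ← hS, Finset.card_ne_zero, Finset.nonempty_iff_ne_empty]
  rintro rfl
  obtain ⟨g, hg⟩ := exists_ne (1 : G ≃g G)
  exact hg (isFixingSet_iff.1 hfix g (by simp))

theorem fixingNumber_le_of_mulEquiv {V : Type*} [Finite V] (G : SimpleGraph V) {k : ℕ}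
    (q : Fin k → ℕ) (hq : ∀ i, IsPrimePow (q i))
    (e : (G ≃g G) ≃* ((i : Fin k) → Multiplicative (ZMod (q i)))) : fixingNumber G ≤ k := by
  obtain ⟨A, hA, hK⟩ := exists_socle q hq
  obtain ⟨S, hS, hS'⟩ := exists_card_le_inf_vertexStabilizer_eq_bot G (A.comap e.toMonoidHom)
  have hcard : Nat.card (A.comap e.toMonoidHom) = Nat.card A :=
    Nat.card_congr (e.toEquiv.subtypeEquiv fun _ => Iff.rfl)
  rw [hcard, hA] at hS
  refine (fixingNumber_le (isFixingSet_iff.2 fun g hg => ?_)).trans hS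
  have hbot : (vertexStabilizer G S).map e.toMonoidHom = ⊥ := by
    refine hK _ ((Subgroup.eq_bot_iff_forall _).2 ?_)
    rintro _ ⟨hxA, y, hy, rfl⟩
    have : y ∈ (⊥ : Subgroup (G ≃g G)) := hS' ▸ ⟨hxA, hy⟩
    rw [Subgroup.mem_bot.1 this, map_one]
  have : e g = 1 := (Subgroup.eq_bot_iff_forall _).1 hbot _ ⟨g, hg, rfl⟩
  exact e.map_eq_one_iff.1 this

/-! ### Encoding vertex colours in a graph -/

/-- A graph encoding the vertex colouring `col` of `G`: the label `j` is joined to all vertices of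
colour at most `j`, and the hub (`true`) is joined to all labels and to a leaf (`false`). -/
def labelledGraph {V : Type*} {n : ℕ} (G : SimpleGraph V) (col : V → Fin n) :
    SimpleGraph (V ⊕ Fin n ⊕ Bool) where
  Adj
    | .inl u, .inl v => G.Adj u v
    | .inl v, .inr (.inl j) => col v ≤ j
    | .inr (.inl j), .inl v => col v ≤ j
    | .inr (.inl _), .inr (.inr b) => b = true
    | .inr (.inr b), .inr (.inl _) => b = true
    | .inr (.inr b), .inr (.inr c) => b ≠ c
    | _, _ => False
  symm := ⟨by
    rintro (u | i | b) (v | j | c) h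
    · exact G.adj_symm h
    · exact h
    · exact h
    · exact h
    · exact h
    · exact h
    · exact h
    · exact h
    · exact Ne.symm (show b ≠ c from h)⟩
  loopless := ⟨by
    rintro (u | i | b) h
    · exact G.loopless.irrefl u h
    · exact h
    · exact h rfl⟩

section labelledGraph

variable {V : Type*} {n : ℕ} {G : SimpleGraph V} {col : V → Fin n}

/-- The leaf is recognizable by its degree: `hG` and the label of its own colour give each vertex of
`G` two neighbours, surjectivity of `col` does so for each label, and the hub has a label and the
leaf. -/
theorem existsUnique_labelledGraph_adj_iff [NeZero n] (hcol : Function.Surjective col)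
    (hG : ∀ v, ∃ w, G.Adj v w) (x : V ⊕ Fin n ⊕ Bool) :
    (∃! w, (labelledGraph G col).Adj x w) ↔ x = .inr (.inr false) := by
  constructor
  · intro h
    rcases x with v | j | b
    · obtain ⟨w, hw⟩ := hG v
      have := h.unique (y₁ := .inl w) (y₂ := .inr (.inl (col v))) hw (le_refl (col v))
      simp at this
    · obtain ⟨v, hv⟩ := hcol j
      have := h.unique (y₁ := .inl v) (y₂ := .inr (.inr true)) hv.le rfl
      simp at this
    · cases b
      · rfl
      · have := h.unique (y₁ := .inr (.inl 0)) (y₂ := .inr (.inr false)) rfl Bool.true_eq_false_eq_False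
        simp at this
  · rintro rfl
    refine ⟨.inr (.inr true), Bool.false_ne_true, ?_⟩
    rintro (v | j | b) h
    · exact h.elim
    · exact absurd h Bool.false_ne_true
    · cases b
      · exact absurd rfl h
      · rfl


theorem labelledGraph_aut_leaf [NeZero n] (hcol : Function.Surjective col) (hG : ∀ v, ∃ w, G.Adj v w)
    (φ : labelledGraph G col ≃g labelledGraph G col) :
    φ (.inr (.inr false)) = .inr (.inr false) := by
  rw [← existsUnique_labelledGraph_adj_iff hcol hG]
  obtain ⟨w, hw, huniq⟩ := (existsUnique_labelledGraph_adj_iff hcol hG _).2 rfl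
  refine ⟨φ w, φ.map_adj_iff.2 hw, fun y hy => ?_⟩
  rw [← φ.apply_symm_apply y] at hy ⊢
  exact congrArg φ (huniq _ (φ.map_adj_iff.1 hy))

theorem labelledGraph_aut_hub [NeZero n] (hcol : Function.Surjective col) (hG : ∀ v, ∃ w, G.Adj v w)
    (φ : labelledGraph G col ≃g labelledGraph G col) :
    φ (.inr (.inr true)) = .inr (.inr true) := by
  refine ((existsUnique_labelledGraph_adj_iff hcol hG _).2 rfl).unique
    (?_ : (labelledGraph G col).Adj (.inr (.inr false)) _) Bool.false_ne_true
  rw [← labelledGraph_aut_leaf hcol hG φ, φ.map_adj_iff]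
  exact Bool.false_ne_true

theorem exists_label_iff (x : V ⊕ Fin n ⊕ Bool) :
    (∃ j, x = .inr (.inl j)) ↔
      (labelledGraph G col).Adj (.inr (.inr true)) x ∧ x ≠ .inr (.inr false) := by
  rcases x with v | j | b
  · simp [labelledGraph]
  · simp [labelledGraph]
  · cases b <;> simp [labelledGraph]

theorem exists_label_aut_iff [NeZero n] (hcol : Function.Surjective col) (hG : ∀ v, ∃ w, G.Adj v w)
    (φ : labelledGraph G col ≃g labelledGraph G col) (x : V ⊕ Fin n ⊕ Bool) :
    (∃ j, φ x = .inr (.inl j)) ↔ ∃ j, x = .inr (.inl j) := by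
  rw [exists_label_iff (G := G) (col := col), exists_label_iff (G := G) (col := col)]
  nth_rw 1 [← labelledGraph_aut_hub hcol hG φ, ← labelledGraph_aut_leaf hcol hG φ]
  rw [φ.map_adj_iff, φ.injective.ne_iff]

/-- Neighbourhoods of labels form a strictly increasing chain because every colour occurs. Degrees
thus tell the labels apart, so no automorphism permutes them. -/
theorem strictMono_ncard_neighborSet_label [Finite V] (hcol : Function.Surjective col) :
    StrictMono fun j => ((labelledGraph G col).neighborSet (.inr (.inl j))).ncard := by
  intro i j hij
  refine Set.ncard_lt_ncard ⟨?_, ?_⟩ (Set.toFinite _)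
  · rintro (v | l | b) h
    · exact le_trans (show col v ≤ i from h) hij.le
    · exact h
    · exact h
  · obtain ⟨v, hv⟩ := hcol j
    intro h
    have : col v ≤ i := h (show (.inl v : V ⊕ Fin n ⊕ Bool) ∈ _ from hv.le)
    exact absurd (hv ▸ this) hij.not_ge

theorem labelledGraph_aut_inr [NeZero n] [Finite V] (hcol : Function.Surjective col)
    (hG : ∀ v, ∃ w, G.Adj v w) (φ : labelledGraph G col ≃g labelledGraph G col)
    (t : Fin n ⊕ Bool) : φ (.inr t) = .inr t := by
  rcases t with j | b
  · obtain ⟨i, hi⟩ := (exists_label_aut_iff hcol hG φ (.inr (.inl j))).2 ⟨j, rfl⟩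
    have h : ((labelledGraph G col).neighborSet (φ (.inr (.inl j)))).ncard =
        ((labelledGraph G col).neighborSet (.inr (.inl j))).ncard :=
      (Nat.card_congr (φ.mapNeighborSet (.inr (.inl j)))).symm
    rw [hi] at h ⊢
    rw [(strictMono_ncard_neighborSet_label hcol).injective h]
  · cases b
    · exact labelledGraph_aut_leaf hcol hG φ
    · exact labelledGraph_aut_hub hcol hG φ

theorem exists_labelledGraph_aut_inl [NeZero n] [Finite V] (hcol : Function.Surjective col)
    (hG : ∀ v, ∃ w, G.Adj v w) (φ : labelledGraph G col ≃g labelledGraph G col) :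
    ∃ σ : V → V, ∀ v, φ (.inl v) = .inl (σ v) := by
  suffices ∀ v, ∃ w : V, φ (.inl v) = .inl w from Classical.skolem.1 this
  intro v
  rcases h : φ (.inl v) with w | t
  · exact ⟨w, rfl⟩
  · rw [← labelledGraph_aut_inr hcol hG φ t] at h
    simpa using φ.injective h

/-- If a group acts faithfully on `V` as the group of all colour-preserving automorphisms of `G`,
then it is the automorphism group of the labelled graph. -/
theorem exists_labelledGraph_aut_mulEquiv [NeZero n] [Finite V] (hcol : Function.Surjective col)
    (hG : ∀ v, ∃ w, G.Adj v w) {A : Type*} [Group A] [MulAction A V] [FaithfulSMul A V]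
    (hadj : ∀ (a : A) u v, G.Adj (a • u) (a • v) ↔ G.Adj u v)
    (hsmul : ∀ (a : A) v, col (a • v) = col v)
    (hall : ∀ σ : V → V, (∀ u v, G.Adj (σ u) (σ v) ↔ G.Adj u v) → (∀ v, col (σ v) = col v) →
      ∃ a : A, ∀ v, σ v = a • v) :
    ∃ e : (labelledGraph G col ≃g labelledGraph G col) ≃* A,
      (∀ φ : labelledGraph G col ≃g labelledGraph G col, ∀ v, φ (.inl v) = .inl (e φ • v)) ∧
        ∀ φ : labelledGraph G col ≃g labelledGraph G col, ∀ t, φ (.inr t) = .inr t := by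
  let f : A →* (labelledGraph G col ≃g labelledGraph G col) :=
    { toFun := fun a =>
        { toEquiv := Equiv.sumCongr (MulAction.toPerm a) (Equiv.refl _)
          map_rel_iff' := by
            rintro (u | i | b) (v | j | c)
            · exact hadj a u v
            · exact (congrArg (· ≤ j) (hsmul a u)).to_iff
            · exact Iff.rfl
            · exact (congrArg (· ≤ i) (hsmul a v)).to_iff
            all_goals exact Iff.rfl }
      map_one' := by
        refine RelIso.ext ?_
        rintro (u | t)
        · exact congrArg Sum.inl (one_smul A u)
        · rfl
      map_mul' := fun a b => by
        refine RelIso.ext ?_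
        rintro (u | t)
        · exact congrArg Sum.inl (mul_smul a b u)
        · rfl }
  have hf : Function.Bijective f := by
    constructor
    · intro a b h
      refine FaithfulSMul.eq_of_smul_eq_smul (α := V) fun v => ?_
      exact Sum.inl_injective (DFunLike.congr_fun h (.inl v))
    · intro φ
      obtain ⟨σ, hσ⟩ := exists_labelledGraph_aut_inl hcol hG φ
      obtain ⟨a, ha⟩ := hall σ
        (fun u v => by
          have := φ.map_adj_iff (v := .inl u) (w := .inl v)
          rw [hσ, hσ] at this
          exact this)
        (fun v => by
          -- Labels are fixed, so `v` and `σ v` are adjacent to the same labels, and the smallest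
          -- such label is the colour.
          refine eq_of_forall_ge_iff fun j => ?_
          have := φ.map_adj_iff (v := .inl v) (w := .inr (.inl j))
          rw [hσ, labelledGraph_aut_inr hcol hG φ] at this
          exact this)
      refine ⟨a, RelIso.ext ?_⟩
      rintro (v | t)
      · rw [hσ, ha]
        rfl
      · exact (labelledGraph_aut_inr hcol hG φ t).symm
  let e := MulEquiv.ofBijective f hf
  refine ⟨e.symm, fun φ v => ?_, fun φ t => labelledGraph_aut_inr hcol hG φ t⟩
  conv_lhs => rw [← e.apply_symm_apply φ]
  rfl

end labelledGraph

/-! ### A graph for a product of groups -/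

section Pi

variable {I : Type} {Γ : I → Type} [∀ i, Group (Γ i)]

/-- The layers of the graph realizing `∏ i, Γ i`: for every `i` there are two layers `none` and
`some none`, and a layer `some (some s)` for each element `s` of the product. Every layer is a copy
of `Γ i`. -/
abbrev PiLayer (Γ : I → Type) : Type := Σ c : I × Option (Option (∀ i, Γ i)), Γ c.1

/-- The arcs between the layers are `x_g → y_{s, g} → z_{g * s i}`. -/
inductive PiArc : PiLayer Γ → PiLayer Γ → Prop
  | source (i : I) (s : ∀ i, Γ i) (g : Γ i) : PiArc ⟨(i, none), g⟩ ⟨(i, some (some s)), g⟩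
  | target (i : I) (s : ∀ i, Γ i) (g : Γ i) :
      PiArc ⟨(i, some (some s)), g⟩ ⟨(i, some none), g * s i⟩

/-- The graph on the layers obtained by forgetting the direction of the arcs. -/
def piGraph (Γ : I → Type) [∀ i, Group (Γ i)] : SimpleGraph (PiLayer Γ) :=
  SimpleGraph.fromRel PiArc

theorem piGraph_adj_source {i : I} {s : ∀ i, Γ i} {g h : Γ i} :
    (piGraph Γ).Adj ⟨(i, none), g⟩ ⟨(i, some (some s)), h⟩ ↔ h = g := by
  rw [piGraph, SimpleGraph.fromRel_adj]
  constructor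
  · rintro ⟨-, h | h⟩ <;> cases h
    rfl
  · rintro rfl
    exact ⟨by simp, .inl (.source i s _)⟩

theorem piGraph_adj_target {i : I} {s : ∀ i, Γ i} {g h : Γ i} :
    (piGraph Γ).Adj ⟨(i, some (some s)), g⟩ ⟨(i, some none), h⟩ ↔ h = g * s i := by
  rw [piGraph, SimpleGraph.fromRel_adj]
  constructor
  · rintro ⟨-, h | h⟩ <;> cases h
    rfl
  · rintro rfl
    exact ⟨by simp, .inl (.target i s _)⟩

theorem exists_piGraph_adj (v : PiLayer Γ) : ∃ w, (piGraph Γ).Adj v w := by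
  obtain ⟨⟨i, _ | _ | s⟩, g⟩ := v
  · exact ⟨⟨(i, some (some 1)), g⟩, piGraph_adj_source.2 rfl⟩
  · exact ⟨⟨(i, some (some 1)), g⟩, (piGraph_adj_target.2 (by simp)).symm⟩
  · exact ⟨⟨(i, none), g⟩, (piGraph_adj_source.2 rfl).symm⟩

instance : MulAction (∀ i, Γ i) (PiLayer Γ) where
  smul p v := ⟨v.1, p v.1.1 * v.2⟩
  one_smul v := Sigma.ext rfl (heq_of_eq (one_mul v.2))
  mul_smul p q v := Sigma.ext rfl (heq_of_eq (mul_assoc (p v.1.1) (q v.1.1) v.2))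

theorem PiLayer.smul_def (p : ∀ i, Γ i) (v : PiLayer Γ) : p • v = ⟨v.1, p v.1.1 * v.2⟩ := rfl

theorem PiLayer.smul_eq_self_iff (p : ∀ i, Γ i) (v : PiLayer Γ) :
    p • v = v ↔ p v.1.1 = 1 := by
  obtain ⟨c, g⟩ := v
  simp [PiLayer.smul_def]

instance : FaithfulSMul (∀ i, Γ i) (PiLayer Γ) where
  eq_of_smul_eq_smul {p q} h := by
    funext i
    simpa [PiLayer.smul_def] using h ⟨(i, none), 1⟩

theorem PiArc.smul {u v : PiLayer Γ} (h : PiArc u v) (p : ∀ i, Γ i) : PiArc (p • u) (p • v) := by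
  cases h with
  | source i s g => exact .source i s (p i * g)
  | target i s g =>
    have := PiArc.target i s (p i * g)
    rw [mul_assoc] at this
    exact this

theorem piGraph_adj_smul (p : ∀ i, Γ i) (u v : PiLayer Γ) :
    (piGraph Γ).Adj (p • u) (p • v) ↔ (piGraph Γ).Adj u v := by
  have hArc : ∀ u v : PiLayer Γ, PiArc (p • u) (p • v) ↔ PiArc u v := fun u v =>
    ⟨fun h => by simpa using h.smul p⁻¹, fun h => h.smul p⟩
  simp only [piGraph, SimpleGraph.fromRel_adj, hArc, ne_eq, smul_left_cancel_iff]

/-- Paths between the outer layers are subdivided Cayley arcs g → g * s i. A map preserving them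
commutes with all right multiplications on `Γ i`, hence is a left translation. -/
theorem exists_eq_smul_of_piGraph_adj_iff (σ : PiLayer Γ → PiLayer Γ)
    (hadj : ∀ u v, (piGraph Γ).Adj (σ u) (σ v) ↔ (piGraph Γ).Adj u v)
    (hlayer : ∀ v, (σ v).1 = v.1) : ∃ p : ∀ i, Γ i, ∀ v, σ v = p • v := by
  classical
  have hex : ∀ (c : I × Option (Option (∀ i, Γ i))) (g : Γ c.1), ∃ h : Γ c.1,
      σ ⟨c, g⟩ = ⟨c, h⟩ := by
    intro c g
    have := hlayer ⟨c, g⟩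
    generalize σ ⟨c, g⟩ = w at this
    obtain ⟨d, h⟩ := w
    cases this
    exact ⟨h, rfl⟩
  choose f hf using hex
  have hy : ∀ i s g, f (i, some (some s)) g = f (i, none) g := by
    intro i s g
    have := (hadj ⟨(i, none), g⟩ ⟨(i, some (some s)), g⟩).2 (piGraph_adj_source.2 rfl)
    rw [hf, hf] at this
    exact piGraph_adj_source.1 this
  have hz : ∀ i (s : ∀ i, Γ i) g, f (i, some none) (g * s i) = f (i, none) g * s i := by
    intro i s g
    have := (hadj ⟨(i, some (some s)), g⟩ ⟨(i, some none), g * s i⟩).2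
      (piGraph_adj_target.2 rfl)
    rw [hf, hf] at this
    rw [← hy i s]
    exact piGraph_adj_target.1 this
  have hzx : ∀ i g, f (i, some none) g = f (i, none) g := fun i g => by
    simpa using hz i 1 g
  have hx : ∀ i g, f (i, none) g = f (i, none) 1 * g := by
    intro i g
    -- The arc from 1 to g determines the image of g from that of 1.
    have := hz i (Pi.mulSingle i g) 1
    rwa [Pi.mulSingle_eq_same, one_mul, hzx] at this
  refine ⟨fun i => f (i, none) 1, ?_⟩
  rintro ⟨⟨i, _ | _ | s⟩, g⟩
  · rw [hf, hx]; rfl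
  · rw [hf, hzx, hx]; rfl
  · rw [hf, hy, hx]; rfl

/-- A finite product of nontrivial finite groups is the automorphism group of a graph whose fixing
number is the number of factors. -/
theorem card_mem_fixingNumbers_pi [Finite I] [Nonempty I] [∀ i, Finite (Γ i)]
    [∀ i, Nontrivial (Γ i)] : Nat.card I ∈ fixingNumbers (∀ i, Γ i) := by
  classical
  have := Fintype.ofFinite I
  obtain ⟨n, ⟨c⟩⟩ := Finite.exists_equiv_fin (I × Option (Option (∀ i, Γ i)))
  have : NeZero n := ⟨by
    rintro rfl
    exact (c (Classical.arbitrary I, none)).elim0⟩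
  let col : PiLayer Γ → Fin n := fun v => c v.1
  obtain ⟨e, hinl, hinr⟩ := exists_labelledGraph_aut_mulEquiv (G := piGraph Γ) (col := col)
    (fun j => ⟨⟨c.symm j, 1⟩, c.apply_symm_apply j⟩) exists_piGraph_adj
    (A := ∀ i, Γ i) piGraph_adj_smul (fun _ _ => rfl)
    (fun σ h h' => exists_eq_smul_of_piGraph_adj_iff σ h fun v => c.injective (h' v))
  refine ⟨_, inferInstance, labelledGraph (piGraph Γ) col, ⟨e⟩, le_antisymm ?_ ?_⟩
  · let S : Finset (PiLayer Γ ⊕ Fin n ⊕ Bool) :=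
      Finset.univ.image fun i : I => .inl ⟨(i, none), 1⟩
    have hS : IsFixingSet (labelledGraph (piGraph Γ) col) S := by
      refine isFixingSet_iff.2 fun φ hφ => e.map_eq_one_iff.1 (funext fun i => ?_)
      have := hφ (.inl ⟨(i, none), 1⟩) (Finset.mem_image_of_mem _ (Finset.mem_univ i))
      rw [hinl] at this
      exact (PiLayer.smul_eq_self_iff _ _).1 (Sum.inl_injective this)
    refine (fixingNumber_le hS).trans (Finset.card_image_le.trans ?_)
    rw [Finset.card_univ, Nat.card_eq_fintype_card]
  · obtain ⟨S, hS, hfix⟩ := exists_isFixingSet_card_eq (labelledGraph (piGraph Γ) col)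
    rw [← hS, Nat.card_eq_fintype_card, ← Finset.card_univ]
    have hmeet : ∀ i : I, ∃ v : PiLayer Γ, .inl v ∈ S ∧ v.1.1 = i := by
      intro i
      by_contra! hi
      obtain ⟨g, hg⟩ := exists_ne (1 : Γ i)
      -- If `S` misses the layers of factor i, a nontrivial element supported on that factor fixes
      -- `S` pointwise.
      have h1 := isFixingSet_iff.1 hfix (e.symm (Pi.mulSingle i g)) ?_
      · rw [e.symm.map_eq_one_iff, Pi.mulSingle_eq_one_iff] at h1
        exact hg h1
      · rintro (v | t) hv
        · rw [hinl, e.apply_symm_apply, (PiLayer.smul_eq_self_iff _ _).2]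
          exact Pi.mulSingle_eq_of_ne (hi v hv) g
        · exact hinr _ t
    choose v hvS hv using hmeet
    refine Finset.card_le_card_of_injOn (fun i => .inl (v i)) (fun i _ => hvS i) ?_
    intro i _ j _ hij
    rw [← hv i, ← hv j, Sum.inl_injective hij]

end Pi

/-! ### Regrouping the cyclic factors -/

theorem fixingNumbers_congr {Γ Δ : Type*} [Group Γ] [Group Δ] (e : Γ ≃* Δ) :
    fixingNumbers Γ = fixingNumbers Δ := by
  ext n
  constructor
  · rintro ⟨V, hV, G, ⟨f⟩, hn⟩
    exact ⟨V, hV, G, ⟨f.trans e⟩, hn⟩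
  · rintro ⟨V, hV, G, ⟨f⟩, hn⟩
    exact ⟨V, hV, G, ⟨f.trans e.symm⟩, hn⟩

/-- A product can be regrouped along the fibres of a map of the index sets. -/
def piFiberMulEquiv {K J : Type*} (f : K → J) (M : K → Type*) [∀ c, Group (M c)] :
    (∀ c, M c) ≃* (∀ j, ∀ c : {c // f c = j}, M c) where
  toFun x _ c := x c
  invFun y c := y (f c) ⟨c, rfl⟩
  left_inv _ := rfl
  right_inv y := by
    funext j ⟨c, hc⟩
    subst hc
    rfl
  map_mul' _ _ := rfl

theorem theorem3 (Γ : Type*) [CommGroup Γ] [Finite Γ] [Nontrivial Γ]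
    (k : ℕ) (q : Fin k → ℕ) (hq : IsElementaryDivisors Γ q) :
    fixingNumbers Γ = Set.Icc 1 k := by
  obtain ⟨hpow, ⟨e⟩⟩ := hq
  ext n
  constructor
  · rintro ⟨V, hV, G, ⟨f⟩, rfl⟩
    have : Nontrivial (G ≃g G) := f.toEquiv.nontrivial
    exact ⟨fixingNumber_pos G, fixingNumber_le_of_mulEquiv G q hpow (f.trans e)⟩
  · rintro ⟨h1, hk⟩
    have : NeZero n := ⟨by omega⟩
    have : ∀ c, Fact (1 < q c) := fun c => ⟨(hpow c).one_lt⟩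
    have : ∀ c, NeZero (q c) := fun c => ⟨(hpow c).ne_zero⟩
    have : ∀ c, Finite (Multiplicative (ZMod (q c))) := fun c =>
      inferInstanceAs (Finite (ZMod (q c)))
    -- The classes are the residues of the indices mod n, all of which occur because n ≤ k.
    have hsurj : Function.Surjective fun c : Fin k => Fin.ofNat n c := fun j =>
      ⟨⟨j, j.2.trans_le hk⟩, Fin.ext (Nat.mod_eq_of_lt j.2)⟩
    have : ∀ j, Nontrivial (∀ c : {c : Fin k // Fin.ofNat n c = j},
        Multiplicative (ZMod (q c))) := fun j =>
      have : ∀ c, Nontrivial (Multiplicative (ZMod (q c))) := fun c =>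
        Multiplicative.toAdd.nontrivial
      (hsurj j).elim fun c hc => Pi.nontrivial_at (⟨c, hc⟩ : {c : Fin k // Fin.ofNat n c = j})
    rw [fixingNumbers_congr (e.trans (piFiberMulEquiv (fun c : Fin k => Fin.ofNat n c) _))]
    have := card_mem_fixingNumbers_pi (I := Fin n)
      (Γ := fun j => ∀ c : {c : Fin k // Fin.ofNat n c = j}, Multiplicative (ZMod (q c)))
    rwa [Nat.card_eq_fintype_card, Fintype.card_fin] at this
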